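/- Let $Y$ be a finite simplicial complex of dimension at most $2$. A core of $Y$ is a subcomplex $K \subseteq Y$ that is $2$-dimensional (in particular, it has at least one $2$-dimensional face) and in which every edge is contained in at least two $2$-dimensional faces. A tetrahedron boundary in $Y$ is a subcomplex of $Y$ consisting of all nonempty proper subsets of some set of four vertices. Suppose that every core of $Y$ contains a tetrahedron boundary, and that any two distinct tetrahedron boundaries in $Y$ have no $2$-dimensional face in common. Then, for every base point $x$ in the geometric realization $|Y|$, the fundamental group $\pi_1(|Y|, x)$ is a free group (possibly trivial). -/

import Mathlib

namespace PreAbstractSimplicialComplex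

/-- A simplicial complex has dimension at most `d` if each of its faces has at most `d + 1`
vertices. -/
def DimLE {V : Type*} (K : PreAbstractSimplicialComplex V) (d : ℕ) : Prop :=
  ∀ s ∈ K.faces, s.card ≤ d + 1

/-- The geometric realization of a finite simplicial complex: the union, over its faces `s`, of the
faces spanned by `s` of the standard simplex in `V → ℝ`, with the subspace topology. -/
def realization {V : Type*} [Fintype V] (K : PreAbstractSimplicialComplex V) : Set (V → ℝ) :=
  {x | x ∈ stdSimplex ℝ V ∧ ∃ s ∈ K.faces, ∀ v, v ∉ s → x v = 0}

/-- A core is a 2-dimensional simplicial complex (so it has at least one 2-dimensional face) in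
which every edge is contained in at least two 2-dimensional faces. -/
structure IsCore {V : Type*} (K : PreAbstractSimplicialComplex V) : Prop where
  dimLE : K.DimLE 2
  exists_face : ∃ s ∈ K.faces, s.card = 3
  two_faces : ∀ e ∈ K.faces, e.card = 2 →
    ∃ s ∈ K.faces, ∃ t ∈ K.faces, s.card = 3 ∧ t.card = 3 ∧ s ≠ t ∧ e ⊆ s ∧ e ⊆ t

/-- The boundary of the simplex with vertex set `T`: its faces are the nonempty proper subsets
of `T`. -/
def simplexBoundary {V : Type*} (T : Finset V) : PreAbstractSimplicialComplex V where
  faces := {s | s.Nonempty ∧ s ⊂ T}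
  isRelLowerSet_faces := fun _ hs => ⟨hs.1, fun _ hts ht => ⟨ht, lt_of_le_of_lt hts hs.2⟩⟩

/-- `L` is the boundary of a tetrahedron. -/
def IsTetrahedronBoundary {V : Type*} (L : PreAbstractSimplicialComplex V) : Prop :=
  ∃ T : Finset V, T.card = 4 ∧ L = simplexBoundary T

/-- Two complexes are face-disjoint if they have no 2-dimensional face in common. -/
def FaceDisjoint {V : Type*} (L M : PreAbstractSimplicialComplex V) : Prop :=
  ∀ s : Finset V, s.card = 3 → s ∈ L.faces → s ∉ M.faces

end PreAbstractSimplicialComplex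

/-! ### Combinatorics: cocycle bases and collapses -/

namespace PreAbstractSimplicialComplex

open Finset

universe u

variable {V : Type u}

/-! Remove one triangle from each tetrahedron boundary. A core of what remains would contain a
tetrahedron boundary, but each of these has lost a triangle; so no core is left, and the complex
collapses through free edges to a graph. The removed triangles do not affect the fundamental group:
face-disjointness keeps the other three triangles of each tetrahedron, and these already fill the
boundary of the missing one.

"Free" is expressed by cocycles. A cocycle basis is a set of oriented edges that freely generates
the edge-path groupoid, stated through its universal property. A graph has one, and both moves
preserve it (`exists_isCocycleBasis_of_collapse`, `exists_isCocycleBasis`).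

To reach topology, `H`-valued cocycles are matched with functors to `H` from the fundamental
groupoid on the vertices of a component. A cocycle defines a covering with fibre `H`, whose holonomy
is the functor (`holonomy_seg`); the functor is determined by its values on edges because every path
is homotopic to an edge path (`edge_induction`). So the groupoid is free, and its vertex groups are
free. -/

/-- A 1-cocycle on a simplicial complex with values in a group, as a labelling of ordered pairs of
vertices. Only the labels of pairs that lie in a common face matter. -/
def IsCocycle {H : Type*} [Group H] (K : PreAbstractSimplicialComplex V) (c : V → V → H) : Prop :=
  ∀ s ∈ K.faces, ∀ a ∈ s, ∀ b ∈ s, ∀ d ∈ s, c b d * c a b = c a d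

/-- A set of oriented edges such that each labelling of them by elements of a group extends to
a unique cocycle. -/
structure IsCocycleBasis (K : PreAbstractSimplicialComplex V) (E : Set (V × V)) : Prop where
  mem_face : ∀ p ∈ E, ∃ s ∈ K.faces, p.1 ∈ s ∧ p.2 ∈ s
  exists_cocycle : ∀ {H : Type u} [Group H] (f : V → V → H),
    ∃ c, K.IsCocycle c ∧ ∀ p ∈ E, c p.1 p.2 = f p.1 p.2
  unique : ∀ {H : Type u} [Group H] (c c' : V → V → H), K.IsCocycle c → K.IsCocycle c' →
    (∀ p ∈ E, c p.1 p.2 = c' p.1 p.2) → ∀ s ∈ K.faces, ∀ a ∈ s, ∀ b ∈ s, c a b = c' a b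

section cocycle

variable {H : Type*} [Group H] {K K' : PreAbstractSimplicialComplex V} {c : V → V → H}

lemma mem_faces_of_subset {s t : Finset V} (hs : s ∈ K.faces) (h : t ⊆ s) (ht : t.Nonempty) :
    t ∈ K.faces := (K.isRelLowerSet_faces hs).2 h ht

lemma nonempty_of_mem_faces {s : Finset V} (hs : s ∈ K.faces) : s.Nonempty :=
  (K.isRelLowerSet_faces hs).1

lemma IsCocycle.self (hc : K.IsCocycle c) {s : Finset V} (hs : s ∈ K.faces) {a : V} (ha : a ∈ s) :
    c a a = 1 := by
  simpa using hc s hs a ha a ha a ha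

lemma IsCocycle.mul_swap (hc : K.IsCocycle c) {s : Finset V} (hs : s ∈ K.faces) {a b : V}
    (ha : a ∈ s) (hb : b ∈ s) : c b a * c a b = 1 := by
  rw [hc s hs a ha b hb a ha, hc.self hs ha]

lemma IsCocycle.mono (hc : K.IsCocycle c) (h : K' ≤ K) : K'.IsCocycle c :=
  fun s hs => hc s (h hs)

/-- If all labels on `s` come from a cone with apex `d`, the cocycle condition holds on `s`. -/
lemma cocycle_condition_of_cone {s : Finset V} {d : V}
    (h : ∀ a ∈ s, ∀ b ∈ s, c d b * c a d = c a b) (h' : ∀ a ∈ s, c a d * c d a = 1) :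
    ∀ a ∈ s, ∀ b ∈ s, ∀ e ∈ s, c b e * c a b = c a e := by
  intro a ha b hb e he
  rw [← h a ha b hb, ← h b hb e he, ← h a ha e he, mul_assoc, ← mul_assoc (c b d), h' b hb, one_mul]

end cocycle

/-- A complex without 2-dimensional faces has a cocycle basis. -/
lemma exists_isCocycleBasis_of_dimLE_one [Finite V] {K : PreAbstractSimplicialComplex V}
    (hK : K.DimLE 1) : ∃ E, K.IsCocycleBasis E := by
  classical
  obtain ⟨n, ⟨e⟩⟩ := Finite.exists_equiv_fin V
  -- The enumeration `e` orients each edge exactly once. In a graph the only cocycle relations are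
  -- degenerate ones, so these labels are independent.
  refine ⟨{p | e p.1 < e p.2 ∧ ∃ s ∈ K.faces, p.1 ∈ s ∧ p.2 ∈ s}, fun p hp => hp.2, ?_, ?_⟩
  · intro H _ f
    refine ⟨fun a b => if e a < e b then f a b else if e b < e a then (f b a)⁻¹ else 1, ?_, ?_⟩
    · intro s hs a ha b hb d hd
      have h3 : a = b ∨ b = d ∨ a = d := by
        by_contra! h
        have : ({a, b, d} : Finset V).card ≤ 2 :=
          (card_le_card (by grind)).trans (hK s hs)
        rw [card_eq_three.2 ⟨a, b, d, h.1, h.2.2, h.2.1, rfl⟩] at this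
        omega
      rcases h3 with rfl | rfl | rfl
      · simp
      · simp
      · rcases lt_trichotomy (e a) (e b) with h | h | h
        · simp [h, h.not_gt]
        · simp [h]
        · simp [h, h.not_gt]
    · intro p hp
      simp [hp.1]
  · intro H _ c c' hc hc' h s hs a ha b hb
    rcases lt_trichotomy (e a) (e b) with hab | hab | hab
    · exact h (a, b) ⟨hab, s, hs, ha, hb⟩
    · obtain rfl := e.injective hab
      rw [hc.self hs ha, hc'.self hs ha]
    · have := h (b, a) ⟨hab, s, hs, hb, ha⟩
      rw [eq_inv_of_mul_eq_one_right (hc.mul_swap hs ha hb),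
        eq_inv_of_mul_eq_one_right (hc'.mul_swap hs ha hb), this]

/-- The complex obtained by removing a set of faces which is closed under passing to larger
faces. -/
def eraseFaces (K : PreAbstractSimplicialComplex V) (R : Set (Finset V))
    (hR : ∀ s ∈ R, ∀ t ∈ K.faces, s ⊆ t → t ∈ R) : PreAbstractSimplicialComplex V where
  faces := K.faces \ R
  isRelLowerSet_faces := fun _ hs => ⟨nonempty_of_mem_faces hs.1, fun _ hts ht =>
    ⟨mem_faces_of_subset hs.1 hts ht, fun h => hs.2 (hR _ h _ hs.1 hts)⟩⟩

/-- A cocycle basis is not affected by removing a triangle together with a free edge. -/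
lemma exists_isCocycleBasis_of_collapse {K K' : PreAbstractSimplicialComplex V} {a b d : V}
    (hab : a ≠ b) (had : a ≠ d) (hbd : b ≠ d) [DecidableEq V]
    (hs : ({a, b, d} : Finset V) ∈ K.faces)
    (hK' : ∀ t, t ∈ K'.faces ↔ t ∈ K.faces ∧ t ≠ {a, b} ∧ t ≠ {a, b, d})
    (hfree : ∀ t ∈ K.faces, a ∈ t → b ∈ t → t = {a, b} ∨ t = {a, b, d})
    (h : ∃ E, K'.IsCocycleBasis E) : ∃ E, K.IsCocycleBasis E := by
  have hle : K' ≤ K := fun t ht => ((hK' t).1 ht).1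
  have hcone : ∀ x ∈ ({a, b, d} : Finset V), ({x, d} : Finset V) ∈ K'.faces := by
    intro x hx
    rw [hK']
    refine ⟨mem_faces_of_subset hs (by grind) (by simp), fun h => ?_, fun h => ?_⟩
    · have : d ∈ ({a, b} : Finset V) := h ▸ by simp
      grind
    · have h1 : a ∈ ({x, d} : Finset V) := h ▸ by simp
      have h2 : b ∈ ({x, d} : Finset V) := h ▸ by simp
      grind
  obtain ⟨E, hE⟩ := h
  refine ⟨E, fun p hp => ?_, ?_, ?_⟩
  · obtain ⟨s, hs, h⟩ := hE.mem_face p hp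
    exact ⟨s, hle hs, h⟩
  · intro H _ f
    obtain ⟨c, hc, hcE⟩ := hE.exists_cocycle f
    -- The relation on the restored triangle forces the label of the free edge: it is read along the
    -- detour through `d`. Hence `E` need not change.
    let c' : V → V → H := fun x y =>
      if x ∈ ({a, b, d} : Finset V) ∧ y ∈ ({a, b, d} : Finset V) then c d y * c x d else c x y
    have hdd : c d d = 1 := hc.self (hcone d (by simp)) (by simp)
    have hcc' : ∀ t ∈ K'.faces, ∀ x ∈ t, ∀ y ∈ t, c' x y = c x y := by
      intro t ht x hx y hy
      by_cases hxy : x ∈ ({a, b, d} : Finset V) ∧ y ∈ ({a, b, d} : Finset V)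
      · simp only [c', if_pos hxy]
        by_cases hxd : x = d
        · subst hxd; rw [hdd, mul_one]
        by_cases hyd : y = d
        · subst hyd; rw [hdd, one_mul]
        by_cases hxy' : x = y
        · subst hxy'
          rw [hc.mul_swap (hcone x hxy.1) (by simp) (by simp), hc.self ht hx]
        -- Distinct `x` and `y` other than `d` are the ends of the free edge, and no face of `K'`
        -- contains both.
        · obtain ⟨htK, h1, h2⟩ := (hK' t).1 ht
          have := hfree t htK (by grind) (by grind)
          tauto
      · simp only [c', if_neg hxy]
    have hd : ∀ x ∈ ({a, b, d} : Finset V), c' x d = c x d ∧ c' d x = c d x := fun x hx =>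
      ⟨hcc' _ (hcone x hx) _ (by simp) _ (by simp), hcc' _ (hcone x hx) _ (by simp) _ (by simp)⟩
    refine ⟨c', ?_, ?_⟩
    · intro t ht
      by_cases ht' : t ∈ K'.faces
      · intro x hx y hy z hz
        rw [hcc' t ht' x hx y hy, hcc' t ht' y hy z hz, hcc' t ht' x hx z hz]
        exact hc t ht' x hx y hy z hz
      · have hts : t ⊆ {a, b, d} := by
          rw [hK'] at ht'
          grind
        refine cocycle_condition_of_cone (d := d) (fun x hx y hy => ?_) (fun x hx => ?_)
        · rw [(hd x (hts hx)).1, (hd y (hts hy)).2]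
          simp only [c', if_pos (And.intro (hts hx) (hts hy))]
        · rw [(hd x (hts hx)).1, (hd x (hts hx)).2]
          exact hc.mul_swap (hcone x (hts hx)) (by simp) (by simp)
    · intro p hp
      obtain ⟨s, hs, h1, h2⟩ := hE.mem_face p hp
      rw [hcc' s hs _ h1 _ h2, hcE p hp]
  · intro H _ c c' hc hc' h t ht x hx y hy
    have huniq := hE.unique c c' (hc.mono hle) (hc'.mono hle) h
    by_cases ht' : t ∈ K'.faces
    · exact huniq t ht' x hx y hy
    · have hts : t ⊆ {a, b, d} := by
        rw [hK'] at ht'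
        grind
      rw [← hc _ hs x (hts hx) d (by simp) y (hts hy), ← hc' _ hs x (hts hx) d (by simp) y (hts hy),
        huniq _ (hcone x (hts hx)) x (by simp) d (by simp),
        huniq _ (hcone y (hts hy)) d (by simp) y (by simp)]

/-! ### Cores, free edges and tetrahedra -/

/-- The subcomplex generated by the 2-dimensional faces. -/
def purePart (K : PreAbstractSimplicialComplex V) : PreAbstractSimplicialComplex V where
  faces := {t | t.Nonempty ∧ ∃ s ∈ K.faces, s.card = 3 ∧ t ⊆ s}
  isRelLowerSet_faces := fun _ ht => ⟨ht.1, fun _ h hne =>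
    ⟨hne, ht.2.choose, ht.2.choose_spec.1, ht.2.choose_spec.2.1, h.trans ht.2.choose_spec.2.2⟩⟩

lemma purePart_le (K : PreAbstractSimplicialComplex V) : K.purePart ≤ K := by
  rintro t ⟨hne, s, hs, -, hts⟩
  exact mem_faces_of_subset hs hts hne

/-- A complex of dimension two without cores has a triangle with a free edge. -/
lemma exists_free_edge [DecidableEq V] {K : PreAbstractSimplicialComplex V} (hdim : K.DimLE 2)
    (hcore : ∀ L ≤ K, ¬ L.IsCore) (h3 : ∃ s ∈ K.faces, s.card = 3) :
    ∃ a b d : V, a ≠ b ∧ a ≠ d ∧ b ≠ d ∧ {a, b, d} ∈ K.faces ∧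
      ∀ t ∈ K.faces, a ∈ t → b ∈ t → t = {a, b} ∨ t = {a, b, d} := by
  by_contra! hcon
  -- If no edge is free, every edge of a triangle lies in a second one. The pure part discards the
  -- edges in no triangle, so it is a core.
  refine hcore K.purePart K.purePart_le ⟨fun s hs => hdim s (K.purePart_le hs), ?_, ?_⟩
  · obtain ⟨s, hs, hs3⟩ := h3
    exact ⟨s, ⟨nonempty_of_mem_faces hs, s, hs, hs3, subset_rfl⟩, hs3⟩
  · rintro e ⟨-, s, hs, hs3, hes⟩ he2
    obtain ⟨a, b, hab, rfl⟩ := card_eq_two.1 he2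
    obtain ⟨d, hd, hd'⟩ : ∃ d ∈ s, d ∉ ({a, b} : Finset V) := by
      by_contra! h
      have := card_le_card h
      omega
    have hsabd : {a, b, d} = s := by
      apply eq_of_subset_of_card_le
      · grind
      · rw [hs3, card_eq_three.2 ⟨a, b, d, hab, by grind, by grind, rfl⟩]
    subst hsabd
    obtain ⟨t, ht, hat, hbt, hne, hne'⟩ := hcon a b d hab (by grind) (by grind) hs
    have hsub : {a, b} ⊆ t := by grind
    have ht3 : t.card = 3 := by
      have := hdim t ht
      have := card_lt_card (hsub.ssubset_of_ne hne.symm)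
      omega
    exact ⟨_, ⟨nonempty_of_mem_faces hs, _, hs, hs3, subset_rfl⟩, t,
      ⟨nonempty_of_mem_faces ht, t, ht, ht3, subset_rfl⟩, hs3, ht3, hne'.symm, hes, hsub⟩

/-- Induction on the number of faces: collapse a free edge while triangles remain. Absence of cores
passes to subcomplexes. -/
lemma exists_isCocycleBasis_of_no_core [Finite V] {K : PreAbstractSimplicialComplex V}
    (hdim : K.DimLE 2) (hcore : ∀ L ≤ K, ¬ L.IsCore) : ∃ E, K.IsCocycleBasis E := by
  classical
  induction hn : K.faces.ncard using Nat.strong_induction_on generalizing K with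
  | _ n ih =>
  by_cases h3 : ∃ s ∈ K.faces, s.card = 3
  · obtain ⟨a, b, d, hab, had, hbd, hs, hfree⟩ := exists_free_edge hdim hcore h3
    let K' := K.eraseFaces {{a, b}, {a, b, d}} (by
      intro s hs t ht hst
      have hst' : {a, b} ⊆ t := by
        rcases hs with rfl | rfl
        · exact hst
        · grind
      exact hfree t ht (by grind) (by grind))
    have hle : K' ≤ K := fun t ht => ht.1
    refine exists_isCocycleBasis_of_collapse (K' := K') hab had hbd hs (fun t => ?_) hfree
      (ih _ ?_ (fun t ht => hdim t (hle ht)) (fun L hL => hcore L (hL.trans hle)) rfl)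
    · simp [K', eraseFaces]
    · rw [← hn]
      refine Set.ncard_lt_ncard ⟨hle, fun h => (h hs).2 (by simp)⟩ (Set.toFinite _)
  · refine exists_isCocycleBasis_of_dimLE_one fun s hs => ?_
    have := hdim s hs
    have : s.card ≠ 3 := fun h => h3 ⟨s, hs, h⟩
    omega

/-- The vertices of `T` are recovered as singleton faces, which are proper subsets because `1 <
T.card`. -/
lemma simplexBoundary_injOn {T T' : Finset V} (hT : 1 < T.card) (hT' : 1 < T'.card)
    (h : simplexBoundary T = simplexBoundary T') : T = T' := by
  have key : ∀ {T T' : Finset V}, 1 < T.card → simplexBoundary T = simplexBoundary T' → T ⊆ T' := by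
    intro T T' hT h x hx
    have : ({x} : Finset V) ∈ (simplexBoundary T).faces := by
      refine ⟨by simp, (singleton_subset_iff.2 hx).ssubset_of_ne ?_⟩
      rintro rfl
      simp at hT
    rw [h] at this
    exact singleton_subset_iff.1 this.2.1
  exact (key hT h).antisymm (key hT' h.symm)

/-- If each core contains a tetrahedron boundary and the tetrahedron boundaries are
face-disjoint, there is a cocycle basis. -/
theorem exists_isCocycleBasis [Finite V] {Y : PreAbstractSimplicialComplex V} (hdim : Y.DimLE 2)
    (hcore : ∀ K : PreAbstractSimplicialComplex V, K ≤ Y → K.IsCore →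
      ∃ L : PreAbstractSimplicialComplex V, L.IsTetrahedronBoundary ∧ L ≤ K)
    (hdisj : ∀ L M : PreAbstractSimplicialComplex V, L.IsTetrahedronBoundary →
      M.IsTetrahedronBoundary → L ≤ Y → M ≤ Y → L ≠ M → L.FaceDisjoint M) :
    ∃ E, Y.IsCocycleBasis E := by
  classical
  obtain _ | _ := isEmpty_or_nonempty V
  · refine exists_isCocycleBasis_of_no_core hdim fun L _ hL => ?_
    obtain ⟨s, -, hs⟩ := hL.exists_face
    simp [Finset.eq_empty_of_isEmpty s] at hs
  have hapex : ∀ T : Finset V, ∃ d, T.card = 4 → d ∈ T := by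
    intro T
    by_cases h : T.Nonempty
    · exact ⟨h.choose, fun _ => h.choose_spec⟩
    · exact ⟨Classical.arbitrary V, fun h4 => (h (card_pos.1 (by omega))).elim⟩
  -- The apex `d T` has an arbitrary value unless `T` has four elements. The removed triangle is the
  -- one opposite the apex.
  choose d hd using hapex
  let R : Set (Finset V) := {s | ∃ T : Finset V, T.card = 4 ∧ simplexBoundary T ≤ Y ∧
    s = T.erase (d T)}
  have hR3 : ∀ s ∈ R, s.card = 3 := by
    rintro s ⟨T, hT, -, rfl⟩
    rw [card_erase_of_mem (hd T hT), hT]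
  let Y' := Y.eraseFaces R (by
    intro s hs t ht hst
    have := hdim t ht
    rwa [← eq_of_subset_of_card_le hst (by rw [hR3 s hs]; omega)])
  have hle : Y' ≤ Y := fun t ht => ht.1
  -- Faces through the apex survive: the triangle removed for `T` misses `d T`, and one removed for
  -- another `T'` would be shared by two tetrahedron boundaries.
  have hmem : ∀ T : Finset V, T.card = 4 → simplexBoundary T ≤ Y → ∀ s, s.Nonempty → s ⊂ T →
      d T ∈ s → s ∈ Y'.faces := by
    intro T hT hTY s hne hs hds
    refine ⟨hTY ⟨hne, hs⟩, ?_⟩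
    rintro ⟨T', hT', hTY', rfl⟩
    by_cases hTT' : T = T'
    · subst hTT'; simp at hds
    · refine hdisj _ _ ⟨T, hT, rfl⟩ ⟨T', hT', rfl⟩ hTY hTY'
        (fun h => hTT' (simplexBoundary_injOn (by omega) (by omega) h)) _
        (hR3 _ ⟨T', hT', hTY', rfl⟩) ⟨hne, hs⟩ ⟨hne, erase_ssubset (hd T' hT')⟩
  have hcore' : ∀ L ≤ Y', ¬ L.IsCore := by
    intro L hL hLc
    obtain ⟨_, ⟨T, hT, rfl⟩, hTL⟩ := hcore L (hL.trans hle) hLc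
    have hmem : T.erase (d T) ∈ (simplexBoundary T).faces := by
      refine ⟨?_, erase_ssubset (hd T hT)⟩
      rw [← card_pos, card_erase_of_mem (hd T hT), hT]
      omega
    exact (hL (hTL hmem)).2 ⟨T, hT, (hTL.trans hL).trans hle, rfl⟩
  have hedge : ∀ s ∈ Y.faces, ∀ x ∈ s, ∀ y ∈ s, ({x, y} : Finset V) ∈ Y'.faces := by
    intro s hs x hx y hy
    refine ⟨mem_faces_of_subset hs (by grind) (by simp), fun h => ?_⟩
    have := hR3 _ h
    have := card_le_two (a := x) (b := y)
    omega
  obtain ⟨E, hE⟩ := exists_isCocycleBasis_of_no_core (fun t ht => hdim t (hle ht)) hcore'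
  refine ⟨E, fun p hp => ?_, ?_, ?_⟩
  · obtain ⟨s, hs, h⟩ := hE.mem_face p hp
    exact ⟨s, hle hs, h⟩
  · intro H _ f
    obtain ⟨c, hc, hcE⟩ := hE.exists_cocycle f
    refine ⟨c, fun s hs => ?_, hcE⟩
    by_cases hs' : s ∈ Y'.faces
    · exact hc s hs'
    obtain ⟨T, hT, hTY, rfl⟩ : s ∈ R := by
      by_contra h
      exact hs' ⟨hs, h⟩
    -- The three surviving triangles form a cone over the boundary of the removed one, so its
    -- cocycle condition is automatic.
    have hface : ∀ x ∈ T.erase (d T), ∀ y ∈ T.erase (d T),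
        ({x, y, d T} : Finset V) ∈ Y'.faces := by
      intro x hx y hy
      refine hmem T hT hTY _ (by simp) (lt_of_le_of_ne ?_ ?_) (by simp)
      · rw [insert_subset_iff, insert_subset_iff, singleton_subset_iff]
        exact ⟨mem_of_mem_erase hx, mem_of_mem_erase hy, hd T hT⟩
      · intro h
        have := card_le_three (a := x) (b := y) (c := d T)
        rw [h] at this
        omega
    refine cocycle_condition_of_cone (d := d T) (fun x hx y hy => ?_) (fun x hx => ?_)
    · exact hc _ (hface x hx y hy) x (by simp) _ (by simp) y (by simp)
    · exact hc.mul_swap (hface x hx x hx) (by simp) (by simp)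
  · intro H _ c c' hc hc' h s hs x hx y hy
    exact hE.unique c c' (hc.mono hle) (hc'.mono hle) h _ (hedge s hs x hx y hy) x (by simp) y
      (by simp)

end PreAbstractSimplicialComplex

/-! ### Paths in the realization and edge paths -/

namespace PreAbstractSimplicialComplex

open unitInterval Topology

universe u

variable {V : Type u} {Y : PreAbstractSimplicialComplex V}

lemma mem_faces_of_mem {s : Finset V} (hs : s ∈ Y.faces) {v : V} (hv : v ∈ s) : {v} ∈ Y.faces :=
  mem_faces_of_subset hs (Finset.singleton_subset_iff.2 hv) (by simp)

variable [Fintype V]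

/-- Two paths inside a star-convex subset of the realization are homotopic. -/
lemma homotopic_of_starConvex {S : Set (V → ℝ)} {c : V → ℝ} (hS : StarConvex ℝ c S)
    (hSY : S ⊆ Y.realization) {x y : Y.realization} (p q : Path x y) (hp : ∀ t, (p t).1 ∈ S)
    (hq : ∀ t, (q t).1 ∈ S) : p.Homotopic q := by
  have hx : x.1 ∈ S := by simpa using hp 0
  have hy : y.1 ∈ S := by simpa using hp 1
  have : ContractibleSpace S := hS.contractibleSpace ⟨_, hx⟩
  let p' : Path (⟨x, hx⟩ : S) ⟨y, hy⟩ :=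
    { toFun := fun t => ⟨p t, hp t⟩
      continuous_toFun := (continuous_subtype_val.comp p.continuous).subtype_mk _
      source' := by simp
      target' := by simp }
  let q' : Path (⟨x, hx⟩ : S) ⟨y, hy⟩ :=
    { toFun := fun t => ⟨q t, hq t⟩
      continuous_toFun := (continuous_subtype_val.comp q.continuous).subtype_mk _
      source' := by simp
      target' := by simp }
  exact (SimplyConnectedSpace.paths_homotopic p' q').map (⟨Set.inclusion hSY,
    continuous_inclusion hSY⟩ : C(S, Y.realization))

/-- The closed face of the realization spanned by the vertices in `s`. -/
def closedFace (s : Finset V) : Set (V → ℝ) := {x | x ∈ stdSimplex ℝ V ∧ ∀ v ∉ s, x v = 0}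

lemma convex_closedFace (s : Finset V) : Convex ℝ (closedFace s) := by
  intro x hx y hy a b ha hb hab
  refine ⟨convex_stdSimplex ℝ V hx.1 hy.1 ha hb hab, fun v hv => ?_⟩
  simp [hx.2 v hv, hy.2 v hv]

lemma closedFace_subset {s : Finset V} (hs : s ∈ Y.faces) : closedFace s ⊆ Y.realization :=
  fun _ hx => ⟨hx.1, s, hs, hx.2⟩

lemma exists_mem_closedFace (x : Y.realization) : ∃ s ∈ Y.faces, x.1 ∈ closedFace s := by
  obtain ⟨s, hs, h⟩ := x.2.2
  exact ⟨s, hs, x.2.1, h⟩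

lemma mem_of_pos {s : Finset V} {x : V → ℝ} (hx : x ∈ closedFace s) {v : V} (hv : 0 < x v) :
    v ∈ s := by
  by_contra h
  exact hv.ne' (hx.2 v h)

lemma exists_pos (x : Y.realization) : ∃ v, 0 < x.1 v := by
  by_contra! h
  have h1 := x.2.1.2
  have : ∑ v, x.1 v ≤ 0 := Finset.sum_nonpos fun v _ => h v
  linarith

open Classical in
/-- The point of the realization given by a vertex. -/
noncomputable def pt (v : {v : V // {v} ∈ Y.faces}) : Y.realization :=
  ⟨Pi.single v.1 1, single_mem_stdSimplex ℝ v.1, {v.1}, v.2, fun w hw =>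
    Pi.single_eq_of_ne (by simpa using hw) _⟩

lemma pt_self (v : {v : V // {v} ∈ Y.faces}) : (pt v).1 v.1 = 1 := by
  simp [pt]

lemma pt_of_ne (v : {v : V // {v} ∈ Y.faces}) {w : V} (h : w ≠ v.1) : (pt v).1 w = 0 := by
  simp [pt, h]

lemma pt_mem_closedFace (v : {v : V // {v} ∈ Y.faces}) {s : Finset V} (hv : v.1 ∈ s) :
    (pt v).1 ∈ closedFace s :=
  ⟨(pt v).2.1, fun w hw => pt_of_ne v (by rintro rfl; exact hw hv)⟩

lemma pt_pos (v : {v : V // {v} ∈ Y.faces}) : 0 < (pt v).1 v.1 := by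
  simp [pt_self]

lemma eq_of_pt_pos (v : {v : V // {v} ∈ Y.faces}) {w : V} (h : 0 < (pt v).1 w) : w = v.1 := by
  by_contra hw
  exact h.ne' (pt_of_ne v hw)

lemma singleton_mem_faces_of_pos {x : Y.realization} {v : V} (hv : 0 < x.1 v) : {v} ∈ Y.faces := by
  obtain ⟨s, hs, hx⟩ := exists_mem_closedFace x
  exact mem_faces_of_mem hs (mem_of_pos hx hv)

/-- The vertex of the complex given by a positive coordinate of a point of the realization. -/
def vertexOfPos {x : Y.realization} {v : V} (hv : 0 < x.1 v) : {v : V // {v} ∈ Y.faces} :=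
  ⟨v, singleton_mem_faces_of_pos hv⟩

/-- The open star of a vertex. -/
def openStar (Y : PreAbstractSimplicialComplex V) (v : V) : Set (V → ℝ) :=
  {x | x ∈ Y.realization ∧ 0 < x v}

/-- Each point of the star shares a closed face with the vertex, so the segment between them stays
in `Y.realization`, and the coordinate at `v` stays positive. -/
lemma starConvex_openStar (v : {v : V // {v} ∈ Y.faces}) :
    StarConvex ℝ (pt v).1 (Y.openStar v.1) := by
  rintro x ⟨hx, hxv⟩ a b ha hb hab
  obtain ⟨s, hs, hxs⟩ := exists_mem_closedFace ⟨x, hx⟩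
  refine ⟨closedFace_subset hs (convex_closedFace s
    (pt_mem_closedFace v (mem_of_pos hxs hxv)) hxs ha hb hab), ?_⟩
  simp only [Pi.add_apply, Pi.smul_apply, smul_eq_mul, pt_self, mul_one]
  rcases ha.eq_or_lt with rfl | ha
  · obtain rfl : b = 1 := by linarith
    simpa using hxv
  · positivity

/-- Two points of the realization lie on a common face. -/
def OnFace (x y : Y.realization) : Prop :=
  ∃ s ∈ Y.faces, x.1 ∈ closedFace s ∧ y.1 ∈ closedFace s

/-- The straight path between two points on a common face. -/
noncomputable def straightPath {x y : Y.realization} (h : OnFace x y) : Path x y where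
  toFun t := ⟨AffineMap.lineMap x.1 y.1 (t : ℝ), by
    obtain ⟨s, hs, hx, hy⟩ := h
    exact closedFace_subset hs ((convex_closedFace s).lineMap_mem hx hy t.2)⟩
  continuous_toFun := by
    refine Continuous.subtype_mk ?_ _
    exact AffineMap.lineMap_continuous.comp continuous_subtype_val
  source' := by simp
  target' := by simp

lemma straightPath_mem {x y : Y.realization} (h : OnFace x y) {S : Set (V → ℝ)} (hS : Convex ℝ S)
    (hx : x.1 ∈ S) (hy : y.1 ∈ S) (t : I) : (straightPath h t).1 ∈ S :=
  hS.lineMap_mem hx hy t.2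

lemma straightPath_pos {x y : Y.realization} (h : OnFace x y) {v : V} (hx : 0 < x.1 v)
    (hy : 0 < y.1 v) (t : I) : 0 < (straightPath h t).1 v :=
  straightPath_mem (S := {z | 0 < z v}) h
    (convex_halfSpace_gt (LinearMap.proj v : (V → ℝ) →ₗ[ℝ] ℝ).isLinear 0) hx hy t

/-- The homotopy class of the straight path between two points on a common face. -/
noncomputable def seg {x y : Y.realization} (h : OnFace x y) : Path.Homotopic.Quotient x y :=
  .mk (straightPath h)

lemma trans_mem {x y z : Y.realization} {p : Path x y} {q : Path y z} {S : Set (V → ℝ)}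
    (hp : ∀ t, (p t).1 ∈ S) (hq : ∀ t, (q t).1 ∈ S) (t : I) : (p.trans q t).1 ∈ S := by
  rw [Path.trans_apply]
  split_ifs
  · exact hp _
  · exact hq _

lemma seg_trans {x y z : Y.realization} {s : Finset V} (hs : s ∈ Y.faces) (hx : x.1 ∈ closedFace s)
    (hy : y.1 ∈ closedFace s) (hz : z.1 ∈ closedFace s) (hxy : OnFace x y) (hyz : OnFace y z)
    (hxz : OnFace x z) : (seg hxy).trans (seg hyz) = seg hxz := by
  rw [seg, seg, ← Path.Homotopic.Quotient.mk_trans]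
  refine Quotient.sound (homotopic_of_starConvex ((convex_closedFace s).starConvex hx)
    (closedFace_subset hs) _ _ (trans_mem ?_ ?_) ?_)
  · exact straightPath_mem _ (convex_closedFace s) hx hy
  · exact straightPath_mem _ (convex_closedFace s) hy hz
  · exact straightPath_mem _ (convex_closedFace s) hx hz

lemma seg_self {x : Y.realization} (h : OnFace x x) : seg h = .refl x := by
  obtain ⟨s, hs, hx, -⟩ := id h
  have := congr_arg (·.trans (seg h).symm) (seg_trans hs hx hx hx h h h)
  simpa using this

lemma OnFace.symm {x y : Y.realization} (h : OnFace x y) : OnFace y x := by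
  obtain ⟨s, hs, hx, hy⟩ := h
  exact ⟨s, hs, hy, hx⟩

lemma seg_symm_trans {x y : Y.realization} (h : OnFace x y) (h' : OnFace y x) :
    (seg h).trans (seg h') = .refl x := by
  obtain ⟨s, hs, hx, hy⟩ := id h
  have hxx : OnFace x x := ⟨s, hs, hx, hx⟩
  rw [seg_trans hs hx hy hx _ _ hxx, seg_self]

lemma onFace_pt {x : Y.realization} {v : V} (hv : 0 < x.1 v) : OnFace x (pt (vertexOfPos hv)) := by
  obtain ⟨s, hs, hx⟩ := exists_mem_closedFace x
  exact ⟨s, hs, hx, pt_mem_closedFace _ (mem_of_pos hx hv)⟩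

/-- A path inside the open star of a vertex is homotopic to the one through this vertex. -/
lemma mk_eq_of_forall_pos {x y : Y.realization} {v : V} (p : Path x y) (hp : ∀ t, 0 < (p t).1 v)
    (hx : 0 < x.1 v) (hy : 0 < y.1 v) :
    Path.Homotopic.Quotient.mk p = (seg (onFace_pt hx)).trans (seg (onFace_pt hy).symm) := by
  change _ = Path.Homotopic.Quotient.mk ((straightPath (onFace_pt hx)).trans
    (straightPath (onFace_pt hy).symm))
  refine Quotient.sound (homotopic_of_starConvex (starConvex_openStar (vertexOfPos hx))
    (fun x hx => hx.1) _ _ (fun t => ⟨(p t).2, hp t⟩) (trans_mem (fun t => ?_) (fun t => ?_)))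
  · exact ⟨Subtype.prop _, straightPath_pos _ hx (pt_pos (vertexOfPos hx)) t⟩
  · exact ⟨Subtype.prop _, straightPath_pos _ (pt_pos (vertexOfPos hx)) hy t⟩

/-- Any property of homotopy classes of paths between vertices that holds for edges and is closed
under concatenation holds for all classes. -/
theorem edge_induction
    {P : ∀ u v : {v : V // {v} ∈ Y.faces}, Path.Homotopic.Quotient (pt u) (pt v) → Prop}
    (hedge : ∀ u v (h : OnFace (pt u) (pt v)), P u v (seg h))
    (htrans : ∀ u v w (p : Path.Homotopic.Quotient (pt u) (pt v))
      (q : Path.Homotopic.Quotient (pt v) (pt w)), P u v p → P v w q → P u w (p.trans q))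
    (u v : {v : V // {v} ∈ Y.faces}) (p : Path.Homotopic.Quotient (pt u) (pt v)) : P u v p := by
  -- Arbitrary end points are joined to vertices of their carriers. Quantifying over all such
  -- vertices lets `Good` be composed at any intermediate point.
  let Good : ∀ x y : Y.realization, Path.Homotopic.Quotient x y → Prop := fun x y p =>
    ∀ u v (hu : 0 < x.1 u) (hv : 0 < y.1 v), P (vertexOfPos hu) (vertexOfPos hv)
      ((seg (onFace_pt hu).symm).trans (p.trans (seg (onFace_pt hv))))
  have hgood_trans : ∀ x y z p q, Good x y p → Good y z q → Good x z (p.trans q) := by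
    intro x y z p q hp hq u v hu hv
    obtain ⟨w, hw⟩ := exists_pos y
    convert htrans _ _ _ _ _ (hp u w hu hw) (hq w v hw hv) using 1
    simp only [Path.Homotopic.Quotient.trans_assoc]
    rw [← Path.Homotopic.Quotient.trans_assoc (seg (onFace_pt hw)), seg_symm_trans,
      Path.Homotopic.Quotient.refl_trans]
  have hgood_star : ∀ x y (p : Path x y) (i : V), (∀ t, 0 < (p t).1 i) → Good x y (.mk p) := by
    intro x y p i hi u v hu hv
    have hx : 0 < x.1 i := by simpa using hi 0
    have hy : 0 < y.1 i := by simpa using hi 1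
    obtain ⟨s, hs, hxs⟩ := exists_mem_closedFace x
    obtain ⟨t, ht, hyt⟩ := exists_mem_closedFace y
    -- Inside one star the path is rerouted through the vertex `i`, and the class becomes a product
    -- of two edges.
    rw [mk_eq_of_forall_pos p hi hx hy]
    have h1 := pt_mem_closedFace (vertexOfPos hu) (mem_of_pos hxs hu)
    have h2 := pt_mem_closedFace (vertexOfPos hx) (mem_of_pos hxs hx)
    have h3 := pt_mem_closedFace (vertexOfPos hx) (mem_of_pos hyt hy)
    have h4 := pt_mem_closedFace (vertexOfPos hv) (mem_of_pos hyt hv)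
    have h12 : OnFace (pt (vertexOfPos hu)) (pt (vertexOfPos hx)) := ⟨s, hs, h1, h2⟩
    have h34 : OnFace (pt (vertexOfPos hx)) (pt (vertexOfPos hv)) := ⟨t, ht, h3, h4⟩
    have := htrans _ _ _ _ _ (hedge _ _ h12) (hedge _ _ h34)
    rw [← seg_trans hs h1 hxs h2 (onFace_pt hu).symm (onFace_pt hx),
      ← seg_trans ht h3 hyt h4 (onFace_pt hy).symm (onFace_pt hv)] at this
    simpa only [Path.Homotopic.Quotient.trans_assoc] using this
  have hgood : ∀ x y (p : Path x y), Good x y (.mk p) := by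
    intro x y p
    -- Lebesgue subdivision: each piece of `p` lies in the open star of one vertex.
    obtain ⟨t, ht0, htm, ⟨n, hn⟩, hsub⟩ := exists_monotone_Icc_subset_open_cover_unitInterval
      (c := fun i : V => {t : I | 0 < (p t).1 i})
      (fun i => isOpen_lt continuous_const
        ((continuous_apply i).comp (continuous_subtype_val.comp p.continuous)))
      (fun t _ => by simpa using exists_pos (p t))
    have key : ∀ k, Good _ _ (.mk (p.subpath (t 0) (t k))) := by
      intro k
      induction k with
      | zero =>
        obtain ⟨i, hi⟩ := exists_pos (p (t 0))
        exact hgood_star _ _ _ i fun s => by simpa using hi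
      | succ k ih =>
        obtain ⟨i, hi⟩ := hsub k
        have h2 := hgood_star _ _ (p.subpath (t k) (t (k + 1))) i fun s => by
          obtain ⟨r, hr, hrs⟩ : p.subpath (t k) (t (k + 1)) s ∈ p '' Set.Icc (t k) (t (k + 1)) := by
            rw [← Path.range_subpath_of_le _ _ _ (htm k.le_succ)]
            exact ⟨s, rfl⟩
          rw [← hrs]
          exact hi hr
        have := hgood_trans _ _ _ _ _ ih h2
        rwa [← Path.Homotopic.Quotient.mk_trans, Path.Homotopic.Quotient.eq.2
          ⟨Path.Homotopy.subpathTransSubpath p (t 0) (t k) (t (k + 1))⟩] at this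
    have h1 := key n
    rw [ht0, hn n le_rfl, Path.subpath_zero_one] at h1
    convert h1 using 1
    · simp
    · simp
    · exact (Path.Homotopic.Quotient.cast_heq p.source p.target (γ := .mk p)).symm
  induction p using Path.Homotopic.Quotient.ind with
  | mk p =>
    have hu : OnFace (pt u) (pt u) := onFace_pt (pt_pos u)
    have hv : OnFace (pt v) (pt v) := onFace_pt (pt_pos v)
    have : P u v ((seg hu).trans ((Path.Homotopic.Quotient.mk p).trans (seg hv))) :=
      hgood _ _ p u.1 v.1 (pt_pos u) (pt_pos v)
    rw [seg_self, seg_self] at this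
    simpa using this

end PreAbstractSimplicialComplex

/-! ### The covering of a cocycle and its holonomy -/

namespace PreAbstractSimplicialComplex

open unitInterval Topology Bundle

universe u

variable {V : Type u} [Fintype V] {Y : PreAbstractSimplicialComplex V}
  {H : Type u} [Group H] [TopologicalSpace H] [DiscreteTopology H] {c : V → V → H}

/-- The bundle over the realization with discrete fibre `H` whose transition functions are given
by a cocycle. -/
noncomputable def cocycleBundle (hc : Y.IsCocycle c) : FiberBundleCore V Y.realization H where
  baseSet v := {x | 0 < x.1 v}
  isOpen_baseSet v := isOpen_lt continuous_const ((continuous_apply v).comp continuous_subtype_val)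
  indexAt x := (exists_pos x).choose
  mem_baseSet_at x := (exists_pos x).choose_spec
  -- Open stars meet only when their vertices lie on a common face, where the cocycle relations are
  -- available.
  coordChange v w _ g := c v w * g
  coordChange_self v x hx g := by
    obtain ⟨s, hs, hxs⟩ := exists_mem_closedFace x
    rw [hc.self hs (mem_of_pos hxs hx), one_mul]
  continuousOn_coordChange v w :=
    ((continuous_of_discreteTopology (f := fun g => c v w * g)).comp continuous_snd).continuousOn
  coordChange_comp u v w x hx g := by
    obtain ⟨s, hs, hxs⟩ := exists_mem_closedFace x
    rw [← mul_assoc, hc s hs u (mem_of_pos hxs hx.1.1) v (mem_of_pos hxs hx.1.2) w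
      (mem_of_pos hxs hx.2)]

lemma isCoveringMap_cocycleBundle (hc : Y.IsCocycle c) :
    IsCoveringMap (cocycleBundle hc).proj :=
  FiberBundle.isCoveringMap (F := H) (E := (cocycleBundle hc).Fiber)

/-- The point over `x` with coordinate `g` in the preferred chart at `x`. -/
noncomputable def bundlePoint (hc : Y.IsCocycle c) (x : Y.realization) (g : H) :
    (cocycleBundle hc).TotalSpace := ⟨x, g⟩

/-- Parallel transport in the bundle of a cocycle. -/
noncomputable def transport (hc : Y.IsCocycle c) {x y : Y.realization}
    (γ : Path.Homotopic.Quotient x y) (g : H) : H :=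
  ((isCoveringMap_cocycleBundle hc).monodromy γ ⟨bundlePoint hc x g, rfl⟩).1.2

lemma bundlePoint_injective (hc : Y.IsCocycle c) {x : Y.realization} {g h : H}
    (hgh : bundlePoint hc x g = bundlePoint hc x h) : g = h :=
  eq_of_heq (TotalSpace.ext_iff.1 hgh).2

lemma monodromy_eq_transport (hc : Y.IsCocycle c) {x y : Y.realization}
    (γ : Path.Homotopic.Quotient x y) (g : H) :
    (isCoveringMap_cocycleBundle hc).monodromy γ ⟨bundlePoint hc x g, rfl⟩ = ⟨bundlePoint hc y (transport hc γ g), rfl⟩ := by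
  unfold transport
  generalize (isCoveringMap_cocycleBundle hc).monodromy γ ⟨bundlePoint hc x g, rfl⟩ = e
  obtain ⟨⟨z, h⟩, hz⟩ := e
  obtain rfl : z = y := hz
  rfl

/-- By uniqueness of path lifting, any explicit lift computes the transport. -/
lemma transport_eq_of_lift (hc : Y.IsCocycle c) {x y : Y.realization} (γ : Path x y) {g h : H}
    (Γ : I → (cocycleBundle hc).TotalSpace) (hΓ : Continuous Γ) (hγ : ∀ t, (Γ t).1 = γ t)
    (h0 : Γ 0 = bundlePoint hc x g) (h1 : Γ 1 = bundlePoint hc y h) : transport hc (.mk γ) g = h := by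
  have hlift := ((isCoveringMap_cocycleBundle hc).eq_liftPath_iff' (γ := γ) (e := bundlePoint hc x g)
    (γ_0 := γ.source) (Γ := ⟨Γ, hΓ⟩)).2 ⟨funext hγ, h0⟩
  have h2 : (isCoveringMap_cocycleBundle hc).monodromy (.mk γ) ⟨bundlePoint hc x g, rfl⟩ = ⟨bundlePoint hc y h, rfl⟩ := by
    refine Subtype.ext ?_
    exact (congr_arg (fun f : C(I, _) => f 1) hlift).symm.trans h1
  rw [monodromy_eq_transport] at h2
  exact bundlePoint_injective hc (congr_arg Subtype.val h2)

lemma exists_lift (hc : Y.IsCocycle c) {x y : Y.realization} (γ : Path x y) (g : H) :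
    ∃ Γ : I → (cocycleBundle hc).TotalSpace, Continuous Γ ∧ (∀ t, (Γ t).1 = γ t) ∧
      Γ 0 = bundlePoint hc x g ∧ Γ 1 = bundlePoint hc y (transport hc (.mk γ) g) := by
  let cov := isCoveringMap_cocycleBundle hc
  refine ⟨cov.liftPath γ (bundlePoint hc x g) γ.source, map_continuous _,
    fun t => congr_fun (cov.liftPath_lifts γ (bundlePoint hc x g) γ.source) t, cov.liftPath_zero .., ?_⟩
  exact congr_arg Subtype.val (monodromy_eq_transport hc (.mk γ) g)

lemma transport_refl (hc : Y.IsCocycle c) (x : Y.realization) (g : H) :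
    transport hc (.refl x) g = g :=
  transport_eq_of_lift hc (Path.refl x) (fun _ => bundlePoint hc x g) continuous_const (fun _ => rfl) rfl rfl

lemma transport_trans (hc : Y.IsCocycle c) {x y z : Y.realization}
    (γ : Path.Homotopic.Quotient x y) (γ' : Path.Homotopic.Quotient y z) (g : H) :
    transport hc (γ.trans γ') g = transport hc γ' (transport hc γ g) := by
  have h := (isCoveringMap_cocycleBundle hc).monodromy_trans_apply γ γ' ⟨bundlePoint hc x g, rfl⟩
  rw [monodromy_eq_transport, monodromy_eq_transport, monodromy_eq_transport] at h
  exact bundlePoint_injective hc (congr_arg Subtype.val h)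

/-- Right translation on the bundle of a cocycle. -/
def rightMul (hc : Y.IsCocycle c) (h : H) (p : (cocycleBundle hc).TotalSpace) :
    (cocycleBundle hc).TotalSpace :=
  ⟨p.1, (show H from p.2) * h⟩

/-- Transition functions multiply on the left, so right translation has the same form in every chart
and pulls basic open sets back to basic open sets. -/
lemma continuous_rightMul (hc : Y.IsCocycle c) (h : H) : Continuous (rightMul hc h) := by
  refine continuous_generateFrom_iff.2 fun s hs => ?_
  simp only [exists_prop, Set.mem_iUnion, Set.mem_singleton_iff] at hs
  obtain ⟨i, t, ht, rfl⟩ := hs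
  have ht' : IsOpen ((fun p : Y.realization × H => (p.1, p.2 * h)) ⁻¹' t) :=
    ht.preimage (continuous_fst.prodMk
      ((continuous_of_discreteTopology (f := fun g => g * h)).comp continuous_snd))
  have hopen : IsOpen (((cocycleBundle hc).localTrivAsPartialEquiv i).source ∩
      (cocycleBundle hc).localTrivAsPartialEquiv i ⁻¹'
        ((fun p : Y.realization × H => (p.1, p.2 * h)) ⁻¹' t)) := by
    apply TopologicalSpace.GenerateOpen.basic
    simp only [exists_prop, Set.mem_iUnion, Set.mem_singleton_iff]
    exact ⟨i, _, ht', rfl⟩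
  convert! hopen using 1
  ext p
  have : (cocycleBundle hc).localTrivAsPartialEquiv i (rightMul hc h p) =
      (((cocycleBundle hc).localTrivAsPartialEquiv i p).1,
        ((cocycleBundle hc).localTrivAsPartialEquiv i p).2 * h) :=
    Prod.ext rfl (mul_assoc _ _ _).symm
  simp only [Set.mem_inter_iff, Set.mem_preimage, this]
  rfl

/-- Right translation carries lifts to lifts. Hence transport is left multiplication by its value at
`1`, which makes holonomy multiplicative. -/
lemma transport_mul (hc : Y.IsCocycle c) {x y : Y.realization}
    (γ : Path.Homotopic.Quotient x y) (g h : H) :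
    transport hc γ (g * h) = transport hc γ g * h := by
  induction γ using Path.Homotopic.Quotient.ind with
  | mk γ =>
    obtain ⟨Γ, hΓ, hγ, h0, h1⟩ := exists_lift hc γ g
    refine transport_eq_of_lift hc γ (fun t => rightMul hc h (Γ t))
      ((continuous_rightMul hc h).comp hΓ) hγ ?_ ?_
    · rw [h0]; rfl
    · rw [h1]; rfl

/-- The value of a cocycle on a homotopy class of paths. -/
noncomputable def holonomy (hc : Y.IsCocycle c) {x y : Y.realization}
    (γ : Path.Homotopic.Quotient x y) : H :=
  transport hc γ 1

lemma holonomy_refl (hc : Y.IsCocycle c) (x : Y.realization) : holonomy hc (.refl x) = 1 :=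
  transport_refl hc x 1

/-- The reversed order is that of composition in `SingleObj H` and of `IsCocycle`. -/
lemma holonomy_trans (hc : Y.IsCocycle c) {x y z : Y.realization}
    (γ : Path.Homotopic.Quotient x y) (γ' : Path.Homotopic.Quotient y z) :
    holonomy hc (γ.trans γ') = holonomy hc γ' * holonomy hc γ := by
  rw [holonomy, transport_trans, ← one_mul (transport hc γ 1), transport_mul]
  rfl

/-- The lift is constant in the chart at `i`; the two factors pass between this chart and the
preferred charts at the ends. -/
lemma holonomy_of_forall_pos (hc : Y.IsCocycle c) {x y : Y.realization} (γ : Path x y) {i : V}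
    (hi : ∀ t, 0 < (γ t).1 i) :
    holonomy hc (.mk γ) = c i ((cocycleBundle hc).indexAt y) *
      c ((cocycleBundle hc).indexAt x) i := by
  let Z := cocycleBundle hc
  have hx : 0 < x.1 i := by simpa using hi 0
  refine transport_eq_of_lift hc γ (fun t => (Z.localTriv i).toOpenPartialHomeomorph.symm
    (γ t, c (Z.indexAt x) i)) ?_ (fun t => rfl) ?_ ?_
  · refine (Z.localTriv i).toOpenPartialHomeomorph.continuousOn_symm.comp_continuous
      (by fun_prop) fun t => ?_
    exact (Z.mem_localTriv_target i _).2 (hi t)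
  · change bundlePoint hc (γ 0) (c i (Z.indexAt (γ 0)) * c (Z.indexAt x) i) = _
    obtain ⟨s, hs, hxs⟩ := exists_mem_closedFace x
    rw [γ.source, hc.mul_swap hs (mem_of_pos hxs (Z.mem_baseSet_at x)) (mem_of_pos hxs hx)]
  · change bundlePoint hc (γ 1) (c i (Z.indexAt (γ 1)) * c (Z.indexAt x) i) = _
    rw [γ.target]

lemma indexAt_pt (hc : Y.IsCocycle c) (v : {v : V // {v} ∈ Y.faces}) :
    (cocycleBundle hc).indexAt (pt v) = v.1 :=
  eq_of_pt_pos v ((cocycleBundle hc).mem_baseSet_at (pt v))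

/-- The holonomy along an edge is the label of the edge. -/
lemma holonomy_seg (hc : Y.IsCocycle c) (u v : {v : V // {v} ∈ Y.faces})
    (h : OnFace (pt u) (pt v)) : holonomy hc (seg h) = c u.1 v.1 := by
  obtain ⟨s, hs, hu, hv⟩ := id h
  have hus : u.1 ∈ s := mem_of_pos hu (pt_pos u)
  have hvs : v.1 ∈ s := mem_of_pos hv (pt_pos v)
  -- The midpoint lies in both stars, so each half of the edge stays in one star. The chart chosen
  -- at the midpoint cancels by the cocycle relation.
  have hm := (convex_closedFace s) hu hv (a := 1 / 2) (b := 1 / 2) (by norm_num) (by norm_num)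
    (by norm_num)
  let m : Y.realization := ⟨_, closedFace_subset hs hm⟩
  have hmu : 0 < m.1 u.1 := by
    have := (pt v).2.1.1 u.1
    simp only [m, Pi.add_apply, Pi.smul_apply, smul_eq_mul, pt_self]
    positivity
  have hmv : 0 < m.1 v.1 := by
    have := (pt u).2.1.1 v.1
    simp only [m, Pi.add_apply, Pi.smul_apply, smul_eq_mul, pt_self]
    positivity
  have h1 : OnFace (pt u) m := ⟨s, hs, hu, hm⟩
  have h2 : OnFace m (pt v) := ⟨s, hs, hm, hv⟩
  have hms : (cocycleBundle hc).indexAt m ∈ s :=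
    mem_of_pos hm ((cocycleBundle hc).mem_baseSet_at m)
  rw [← seg_trans hs hu hm hv h1 h2 h, holonomy_trans, seg, seg,
    holonomy_of_forall_pos hc _ (straightPath_pos h1 (pt_pos u) hmu),
    holonomy_of_forall_pos hc _ (straightPath_pos h2 hmv (pt_pos v)), indexAt_pt, indexAt_pt,
    hc.self hs hus, hc.self hs hvs, one_mul, mul_one, hc s hs _ hus _ hms _ hvs]

end PreAbstractSimplicialComplex

/-! ### The fundamental groupoid on vertices is free -/

namespace PreAbstractSimplicialComplex

open CategoryTheory

universe u

variable {V : Type u} [Fintype V] {Y : PreAbstractSimplicialComplex V}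

/-- The vertices in the path component of `x`. -/
structure ComponentVertex (x : Y.realization) : Type u where
  vertex : {v : V // {v} ∈ Y.faces}
  joined : Joined x (pt vertex)

namespace ComponentVertex

variable {x : Y.realization}

/-- The full subgroupoid of the fundamental groupoid on the vertices in a path component. -/
noncomputable instance : Groupoid (ComponentVertex x) where
  Hom a b := Path.Homotopic.Quotient (pt a.vertex) (pt b.vertex)
  id _ := .refl _
  comp := .trans
  id_comp := Path.Homotopic.Quotient.refl_trans
  comp_id := Path.Homotopic.Quotient.trans_refl
  assoc := Path.Homotopic.Quotient.trans_assoc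
  inv := .symm
  inv_comp := Path.Homotopic.Quotient.symm_trans
  comp_inv := Path.Homotopic.Quotient.trans_symm

lemma nonempty_hom (a b : ComponentVertex x) : Nonempty (a ⟶ b) :=
  ⟨.mk (a.joined.symm.trans b.joined).somePath⟩

lemma exists_of_realization (x : Y.realization) : Nonempty (ComponentVertex x) := by
  obtain ⟨v, hv⟩ := exists_pos x
  exact ⟨⟨vertexOfPos hv, ⟨straightPath (onFace_pt hv)⟩⟩⟩

instance : IsConnected (ComponentVertex x) :=
  have := exists_of_realization x
  zigzag_isConnected fun a b => Zigzag.of_hom (nonempty_hom a b).some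

/-- The morphism given by an edge. -/
noncomputable def edge (a b : ComponentVertex x) (h : OnFace (pt a.vertex) (pt b.vertex)) :
    a ⟶ b :=
  seg h

lemma edge_comp {a b d : ComponentVertex x} {s : Finset V} (hs : s ∈ Y.faces)
    (ha : a.vertex.1 ∈ s) (hb : b.vertex.1 ∈ s) (hd : d.vertex.1 ∈ s)
    (hab : OnFace (pt a.vertex) (pt b.vertex)) (hbd : OnFace (pt b.vertex) (pt d.vertex))
    (had : OnFace (pt a.vertex) (pt d.vertex)) : edge a b hab ≫ edge b d hbd = edge a d had :=
  seg_trans hs (pt_mem_closedFace _ ha) (pt_mem_closedFace _ hb) (pt_mem_closedFace _ hd) _ _ _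

lemma onFace_of_mem {u v : {v : V // {v} ∈ Y.faces}} {s : Finset V} (hs : s ∈ Y.faces)
    (hu : u.1 ∈ s) (hv : v.1 ∈ s) : OnFace (pt u) (pt v) :=
  ⟨s, hs, pt_mem_closedFace _ hu, pt_mem_closedFace _ hv⟩

/-- Vertices of a face lie in the same path component. -/
lemma joined_of_mem {u v : {v : V // {v} ∈ Y.faces}} {s : Finset V} (hs : s ∈ Y.faces)
    (hu : u.1 ∈ s) (hv : v.1 ∈ s) (h : Joined x (pt u)) : Joined x (pt v) :=
  h.trans ⟨straightPath (onFace_of_mem hs hu hv)⟩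

/-- Functors to a group that agree on edges are equal. -/
lemma functor_ext {H : Type u} [Group H] {F G : ComponentVertex x ⥤ SingleObj H}
    (h : ∀ a b hab, F.map (edge a b hab) = G.map (edge a b hab)) : F = G := by
  refine CategoryTheory.Functor.ext (fun _ => rfl) fun a b p => ?_
  simp only [eqToHom_refl, Category.id_comp, Category.comp_id]
  have key := edge_induction (Y := Y)
    (P := fun u v p => ∀ (hu : Joined x (pt u)) (hv : Joined x (pt v)),
      F.map (X := ⟨u, hu⟩) (Y := ⟨v, hv⟩) p = G.map (X := ⟨u, hu⟩) (Y := ⟨v, hv⟩) p)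
    (fun u v huv hu hv => h ⟨u, hu⟩ ⟨v, hv⟩ huv)
    (fun u v w p q hp hq hu hw => by
      -- The intermediate vertex lies in the component of `x` because `p` itself joins it to `u`.
      have hv : Joined x (pt v) := by
        induction p using Path.Homotopic.Quotient.ind with
        | mk p => exact hu.trans ⟨p⟩
      have h1 := F.map_comp (X := ⟨u, hu⟩) (Y := ⟨v, hv⟩) (Z := ⟨w, hw⟩) p q
      have h2 := G.map_comp (X := ⟨u, hu⟩) (Y := ⟨v, hv⟩) (Z := ⟨w, hw⟩) p q
      rw [hp hu hv, hq hv hw] at h1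
      exact h1.trans h2.symm)
  exact key a.vertex b.vertex p a.joined b.joined

/-- The functor given by the holonomy of a cocycle. -/
noncomputable def holonomyFunctor (x : Y.realization) {H : Type u} [Group H] [TopologicalSpace H]
    [DiscreteTopology H] {c : V → V → H} (hc : Y.IsCocycle c) :
    ComponentVertex x ⥤ SingleObj H where
  obj _ := SingleObj.star H
  map γ := holonomy hc γ
  map_id _ := holonomy_refl hc _
  map_comp γ γ' := holonomy_trans hc γ γ'

lemma exists_functor (x : Y.realization) {H : Type u} [Group H] {c : V → V → H}
    (hc : Y.IsCocycle c) : ∃ F : ComponentVertex x ⥤ SingleObj H,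
      ∀ a b h, F.map (edge a b h) = c a.vertex.1 b.vertex.1 := by
  let : TopologicalSpace H := ⊥
  have : DiscreteTopology H := ⟨rfl⟩
  exact ⟨holonomyFunctor x hc, fun a b h => holonomy_seg hc _ _ h⟩

open Classical in
/-- A functor to a group gives a cocycle, extended by `c` to the other components. -/
noncomputable def cocycleOfFunctor {H : Type u} [Group H] (F : ComponentVertex x ⥤ SingleObj H)
    (c : V → V → H) (u v : V) : H :=
  if h : ∃ (hu : {u} ∈ Y.faces) (hv : {v} ∈ Y.faces),
      Joined x (pt ⟨u, hu⟩) ∧ Joined x (pt ⟨v, hv⟩) ∧ OnFace (pt ⟨u, hu⟩) (pt ⟨v, hv⟩) then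
    F.map (edge ⟨⟨u, h.1⟩, h.2.2.1⟩ ⟨⟨v, h.2.1⟩, h.2.2.2.1⟩ h.2.2.2.2)
  else c u v

lemma cocycleOfFunctor_edge {H : Type u} [Group H] (F : ComponentVertex x ⥤ SingleObj H)
    (c : V → V → H) (a b : ComponentVertex x) (h : OnFace (pt a.vertex) (pt b.vertex)) :
    cocycleOfFunctor F c a.vertex.1 b.vertex.1 = F.map (edge a b h) :=
  dif_pos ⟨a.vertex.2, b.vertex.2, a.joined, b.joined, h⟩

lemma cocycleOfFunctor_of_not_joined {H : Type u} [Group H] (F : ComponentVertex x ⥤ SingleObj H)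
    (c : V → V → H) (u v : {v : V // {v} ∈ Y.faces}) (h : ¬ Joined x (pt u)) :
    cocycleOfFunctor F c u.1 v.1 = c u.1 v.1 :=
  dif_neg fun ⟨_, _, h', _⟩ => h h'

/-- A face lies in a single component, so its relations come entirely from `F` or entirely from `c`.
-/
lemma isCocycle_cocycleOfFunctor {H : Type u} [Group H] (F : ComponentVertex x ⥤ SingleObj H)
    {c : V → V → H} (hc : Y.IsCocycle c) : Y.IsCocycle (cocycleOfFunctor F c) := by
  intro s hs u hu v hv w hw
  let u' : {v : V // {v} ∈ Y.faces} := ⟨u, mem_faces_of_mem hs hu⟩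
  let v' : {v : V // {v} ∈ Y.faces} := ⟨v, mem_faces_of_mem hs hv⟩
  let w' : {v : V // {v} ∈ Y.faces} := ⟨w, mem_faces_of_mem hs hw⟩
  by_cases h : Joined x (pt u')
  · let a : ComponentVertex x := ⟨u', h⟩
    let b : ComponentVertex x := ⟨v', joined_of_mem hs hu hv h⟩
    let d : ComponentVertex x := ⟨w', joined_of_mem hs hu hw h⟩
    have hab : OnFace (pt a.vertex) (pt b.vertex) := onFace_of_mem hs hu hv
    have hbd : OnFace (pt b.vertex) (pt d.vertex) := onFace_of_mem hs hv hw
    have had : OnFace (pt a.vertex) (pt d.vertex) := onFace_of_mem hs hu hw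
    have := F.map_comp (edge a b hab) (edge b d hbd)
    rw [edge_comp hs hu hv hw _ _ had, ← cocycleOfFunctor_edge F c,
      ← cocycleOfFunctor_edge F c, ← cocycleOfFunctor_edge F c] at this
    exact this.symm
  · have h' : ¬ Joined x (pt v') := fun h' => h (joined_of_mem hs hv hu h')
    have e1 := cocycleOfFunctor_of_not_joined F c u' v' h
    have e2 := cocycleOfFunctor_of_not_joined F c u' w' h
    have e3 := cocycleOfFunctor_of_not_joined F c v' w' h'
    simp only [u', v', w'] at e1 e2 e3
    rw [e1, e2, e3, hc s hs u hu v hv w hw]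

lemma mem_face_of_onFace {u v : {v : V // {v} ∈ Y.faces}} (h : OnFace (pt u) (pt v)) :
    ∃ s ∈ Y.faces, u.1 ∈ s ∧ v.1 ∈ s := by
  obtain ⟨s, hs, hu, hv⟩ := h
  exact ⟨s, hs, mem_of_pos hu (pt_pos u), mem_of_pos hv (pt_pos v)⟩

/-- A cocycle basis freely generates the groupoid of vertices in a path component. -/
@[reducible]
noncomputable def isFreeGroupoid {E : Set (V × V)} (hE : Y.IsCocycleBasis E) (x : Y.realization) :
    IsFreeGroupoid (ComponentVertex x) where
  -- Membership in `E` is a proposition; pairing it with `PUnit` puts the generators in the required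
  -- universe.
  quiverGenerators :=
    ⟨fun a b => {_w : PUnit.{u + 1} // ((vertex a).1, (vertex b).1) ∈ E}⟩
  of {a b} e := edge a b (by
    obtain ⟨s, hs, ha, hb⟩ := hE.mem_face _ e.2
    exact onFace_of_mem hs ha hb)
  unique_lift {H} _ f := by
    classical
    -- Cocycles live on all of `Y`, so the labelling is extended by `1` outside the component.
    let f' : V → V → H := fun u v =>
      if h : ∃ (hu : {u} ∈ Y.faces) (hv : {v} ∈ Y.faces),
          Joined x (pt ⟨u, hu⟩) ∧ Joined x (pt ⟨v, hv⟩) ∧ (u, v) ∈ E then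
        @f (⟨⟨u, h.1⟩, h.2.2.1⟩ : ComponentVertex x) (⟨⟨v, h.2.1⟩, h.2.2.2.1⟩ : ComponentVertex x)
          ⟨⟨⟩, h.2.2.2.2⟩
      else 1
    obtain ⟨c, hc, hcE⟩ := hE.exists_cocycle f'
    obtain ⟨F, hF⟩ := exists_functor x hc
    have hFf : ∀ (a b : ComponentVertex x) (h : OnFace (pt a.vertex) (pt b.vertex))
        (hab : (a.vertex.1, b.vertex.1) ∈ E), F.map (edge a b h) = @f a b ⟨⟨⟩, hab⟩ := by
      intro a b h hab
      rw [hF, hcE _ hab]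
      exact dif_pos ⟨a.vertex.2, b.vertex.2, a.joined, b.joined, hab⟩
    refine ⟨F, fun a b e => hFf a b _ e.2, fun G hG => functor_ext fun a b hab => ?_⟩
    obtain ⟨s, hs, ha, hb⟩ := mem_face_of_onFace hab
    -- A competing functor `G` is turned into a cocycle equal to `c` off the component, so that
    -- uniqueness on all of `Y` applies.
    rw [← cocycleOfFunctor_edge G c, hF]
    refine hE.unique _ _ (isCocycle_cocycleOfFunctor G hc) hc ?_ s hs _ ha _ hb
    rintro ⟨u, v⟩ huv
    obtain ⟨s, hs, hu, hv⟩ := hE.mem_face _ huv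
    let u' : {v : V // {v} ∈ Y.faces} := ⟨u, mem_faces_of_mem hs hu⟩
    let v' : {v : V // {v} ∈ Y.faces} := ⟨v, mem_faces_of_mem hs hv⟩
    by_cases h : Joined x (pt u')
    · let a : ComponentVertex x := ⟨u', h⟩
      let b : ComponentVertex x := ⟨v', joined_of_mem hs hu hv h⟩
      have hab : OnFace (pt a.vertex) (pt b.vertex) := onFace_of_mem hs hu hv
      exact (cocycleOfFunctor_edge G c a b hab).trans
        ((hG a b ⟨⟨⟩, huv⟩).trans ((hFf a b hab huv).symm.trans (hF a b hab)))
    · exact cocycleOfFunctor_of_not_joined G c u' v' h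

end ComponentVertex

/-- The fundamental group of a complex with a cocycle basis is free. -/
theorem IsCocycleBasis.isFreeGroup {E : Set (V × V)} (hE : Y.IsCocycleBasis E)
    (x : Y.realization) : IsFreeGroup (FundamentalGroup Y.realization x) := by
  obtain ⟨a⟩ := ComponentVertex.exists_of_realization x
  let := ComponentVertex.isFreeGroupoid hE x
  -- Vertex groups of a connected free groupoid are free: the generators outside a spanning tree
  -- give a basis.
  have hfree : IsFreeGroup (End a) := inferInstance
  have e : End a ≃* FundamentalGroup Y.realization (pt a.vertex) :=
    { toFun := fun f => f
      invFun := fun f => f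
      left_inv := fun _ => rfl
      right_inv := fun _ => rfl
      map_mul' := fun _ _ => rfl }
  exact IsFreeGroup.ofMulEquiv
    (e.trans (FundamentalGroup.fundamentalGroupMulEquivOfPath a.joined.somePath.symm))

end PreAbstractSimplicialComplex

theorem proposition5 {V : Type*} [Fintype V] (Y : PreAbstractSimplicialComplex V)
    (hdim : Y.DimLE 2)
    (hcore : ∀ K : PreAbstractSimplicialComplex V, K ≤ Y → K.IsCore →
      ∃ L : PreAbstractSimplicialComplex V, L.IsTetrahedronBoundary ∧ L ≤ K)
    (hdisj : ∀ L M : PreAbstractSimplicialComplex V, L.IsTetrahedronBoundary →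
      M.IsTetrahedronBoundary → L ≤ Y → M ≤ Y → L ≠ M → L.FaceDisjoint M)
    (x : Y.realization) :
    IsFreeGroup (FundamentalGroup Y.realization x) := by
  obtain ⟨E, hE⟩ := PreAbstractSimplicialComplex.exists_isCocycleBasis hdim hcore hdisj
  exact hE.isFreeGroup x
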